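/- Let $M$ be a connected, complete, non-compact smooth Riemannian manifold. For an open set $\Omega\subset M$ let $L^2_{1,0}(\Omega)$ be the completion of $C_0^\infty(\Omega)$ with respect to the norm $\|\varphi\|^2=\int_\Omega\varphi^2+\int_\Omega|\nabla\varphi|^2$, and set $$\lambda_1(\Omega)=\inf\Big\{\frac{\int_\Omega|\nabla f|^2}{\int_\Omega f^2} : f\in L^2_{1,0}(\Omega)\setminus\{0\}\Big\},\qquad \lambda_1(M)=\lim_{r\to\infty}\lambda_1(B_M(p,r)),$$ where $B_M(p,r)$ is the geodesic ball of radius $r$ centered at $p\in M$ (the limit exists and does not depend on $p$). If $\lambda_1(M)=0$, then there is no smooth vector field $X$ on $M$ with $\sup_M|X|<\infty$ and $\inf_M\operatorname{div}X>0$. In particular, for every $n$, there is no smooth vector field $X$ on $\mathbb{R}^n$ (with its Euclidean metric) with $\sup_{\mathbb{R}^n}|X|<\infty$ and $\inf_{\mathbb{R}^n}\operatorname{div}X>0$. -/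

import Mathlib

open Set Filter Topology MeasureTheory Bundle
open scoped Manifold ContDiff ENNReal

noncomputable section

namespace RiemannianSpectrum

variable {n : ℕ} {M : Type*} [TopologicalSpace M] [ChartedSpace (EuclideanSpace ℝ (Fin n)) M]

section Coordinates

variable [RiemannianBundle (fun x : M ↦ TangentSpace (𝓡 n) x)]

/-- The coordinate vector `∂/∂yⁱ` of the preferred chart at `x`, at the point with coordinates `y`:
the image of the `i`-th standard basis vector under the differential of the inverse chart. -/
def coordVector (x : M) (y : EuclideanSpace ℝ (Fin n)) (i : Fin n) :
    TangentSpace (𝓡 n) ((extChartAt (𝓡 n) x).symm y) :=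
  mfderiv (𝓡 n) (𝓡 n) (extChartAt (𝓡 n) x).symm y (EuclideanSpace.single i (1 : ℝ))

/-- The coefficients `g_{ij}` of the Riemannian metric in the preferred chart at `x`. -/
def metricMatrix (x : M) (y : EuclideanSpace ℝ (Fin n)) : Matrix (Fin n) (Fin n) ℝ :=
  Matrix.of fun i j ↦ inner ℝ (coordVector x y i) (coordVector x y j)

/-- The Riemannian volume density `√(det g_{ij})` in the preferred chart at `x`. -/
def volumeDensity (x : M) (y : EuclideanSpace ℝ (Fin n)) : ℝ :=
  √(metricMatrix x y).det

/-- The components of the vector field `X` in the preferred chart at `x`, as functions of the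
coordinates. -/
def coordComponents (X : Π x : M, TangentSpace (𝓡 n) x) (x : M)
    (y : EuclideanSpace ℝ (Fin n)) : EuclideanSpace ℝ (Fin n) :=
  mfderiv (𝓡 n) (𝓡 n) (extChartAt (𝓡 n) x) ((extChartAt (𝓡 n) x).symm y)
    (X ((extChartAt (𝓡 n) x).symm y))

/-- The Riemannian divergence of a vector field,
`div X = (1 / √(det g)) ∑ᵢ ∂ᵢ (√(det g) Xⁱ)`, computed at `x` in the preferred chart at `x`. -/
def divergence (X : Π x : M, TangentSpace (𝓡 n) x) (x : M) : ℝ :=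
  (volumeDensity x (extChartAt (𝓡 n) x x))⁻¹ *
    ∑ i : Fin n,
      fderiv ℝ (fun y ↦ volumeDensity x y * coordComponents X x y i) (extChartAt (𝓡 n) x x)
        (EuclideanSpace.single i (1 : ℝ))

/-- The Riemannian volume of the domain of the preferred chart at `x`, extended by `0` to `M`:
the push-forward of `√(det g) dy` under the inverse chart. -/
def chartVolume [MeasurableSpace M] (x : M) : Measure M :=
  ((volume.restrict (extChartAt (𝓡 n) x).target).withDensity
    (fun y ↦ ENNReal.ofReal (volumeDensity x y))).map (extChartAt (𝓡 n) x).symm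

variable (n M) in
/-- The Riemannian volume measure of `M`. By the change of variables formula, the measures
`chartVolume x` and `chartVolume x'` agree on the intersection of the two chart domains. The
smallest measure above all of them is the measure which restricts to `chartVolume x` on every
chart domain. -/
def riemannianVolume [MeasurableSpace M] : Measure M :=
  ⨆ x : M, chartVolume (n := n) x

/-- The gradient of `f : M → ℝ` at `x`: the tangent vector with
`⟪grad f x, v⟫ = df_x v` for all `v`. -/
def grad (f : M → ℝ) (x : M) : TangentSpace (𝓡 n) x :=
  haveI : FiniteDimensional ℝ (TangentSpace (𝓡 n) x) :=
    inferInstanceAs (FiniteDimensional ℝ (EuclideanSpace ℝ (Fin n)))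
  haveI : CompleteSpace (TangentSpace (𝓡 n) x) := FiniteDimensional.complete ℝ _
  (InnerProductSpace.toDual ℝ (TangentSpace (𝓡 n) x)).symm (mvfderiv (𝓡 n) f x)

end Coordinates

variable (n) in
/-- `C₀^∞(Ω)`: smooth functions with compact support contained in `Ω`. -/
def IsTestFunction (Ω : Set M) (φ : M → ℝ) : Prop :=
  ContMDiff (𝓡 n) 𝓘(ℝ, ℝ) ∞ φ ∧ HasCompactSupport φ ∧ tsupport φ ⊆ Ω

variable [RiemannianBundle (fun x : M ↦ TangentSpace (𝓡 n) x)] [MeasurableSpace M]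

variable (n) in
/-- `∫_Ω f²` with respect to the Riemannian volume. -/
def mass (Ω : Set M) (f : M → ℝ) : ℝ≥0∞ :=
  ∫⁻ x in Ω, ‖f x‖ₑ ^ 2 ∂(riemannianVolume n M)

variable (n) in
/-- `∫_Ω |∇ φ|²` with respect to the Riemannian volume, for differentiable `φ`. -/
def energy (Ω : Set M) (φ : M → ℝ) : ℝ≥0∞ :=
  ∫⁻ x in Ω, ‖grad (n := n) φ x‖ₑ ^ 2 ∂(riemannianVolume n M)

variable (n) in
/-- `f` is (a representative of) an element of `L²_{1,0}(Ω)`, the completion of `C₀^∞(Ω)` for the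
norm `(∫_Ω φ² + ∫_Ω |∇ φ|²)^(1/2)`, and `D = ∫_Ω |∇ f|²`. The completion is realized inside
`L²(Ω)`: `f` is the `L²(Ω)`-limit of a sequence of test functions which is Cauchy for this norm,
and `∫_Ω |∇ f|²` is the limit of `∫_Ω |∇ φ|²` along the sequence. -/
def IsSobolevWithEnergy (Ω : Set M) (f : M → ℝ) (D : ℝ≥0∞) : Prop :=
  AEStronglyMeasurable f ((riemannianVolume n M).restrict Ω) ∧
  ∃ φ : ℕ → M → ℝ,
    (∀ k, IsTestFunction n Ω (φ k)) ∧
    Tendsto (fun p : ℕ × ℕ ↦ mass n Ω (φ p.1 - φ p.2) + energy n Ω (φ p.1 - φ p.2))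
      atTop (𝓝 0) ∧
    Tendsto (fun k ↦ mass n Ω (φ k - f)) atTop (𝓝 0) ∧
    Tendsto (fun k ↦ energy n Ω (φ k)) atTop (𝓝 D)

variable (n) in
/-- The first Dirichlet eigenvalue of `Ω`: the infimum of the Rayleigh quotients
`∫_Ω |∇ f|² / ∫_Ω f²` over the nonzero elements `f` of `L²_{1,0}(Ω)`. -/
def firstEigenvalue (Ω : Set M) : ℝ≥0∞ :=
  sInf {l | ∃ (f : M → ℝ) (D : ℝ≥0∞), IsSobolevWithEnergy n Ω f D ∧
    ¬ f =ᵐ[(riemannianVolume n M).restrict Ω] 0 ∧ l = D / mass n Ω f}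

end RiemannianSpectrum

namespace RiemannianSpectrum

variable (n : ℕ) {M : Type*} [MetricSpace M] [ChartedSpace (EuclideanSpace ℝ (Fin n)) M]
  [RiemannianBundle (fun x : M ↦ TangentSpace (𝓡 n) x)] [MeasurableSpace M]

/-- The first eigenvalue `λ₁(M) = lim_{r → ∞} λ₁(B(p, r))` of a complete non-compact Riemannian
manifold. The function of `r` is nonincreasing, so the limit exists; it does not depend on the
center `p`. -/
def firstEigenvalueManifold (p : M) : ℝ≥0∞ :=
  limUnder atTop (fun r : ℝ ↦ firstEigenvalue n (Metric.ball p r))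

end RiemannianSpectrum

end

/-! Suppose `|X| ≤ C` and `div X ≥ c > 0`. Applying the divergence theorem to `φ² X`, for a test
function `φ`, gives `c ∫ φ² ≤ ∫ φ² div X = -2 ∫ φ ⟨∇φ, X⟩ ≤ 2C ∫ |φ| |∇φ|`, and Young's inequality
absorbs half of the left side, leaving `∫ φ² ≤ (4C²/c²) ∫ |∇φ|²` (`IsTestFunction.mass_le_energy`).
The constant does not depend on the support of `φ`. The bound passes to limits in `L²_{1,0}`
(`le_firstEigenvalue`) and holds on every ball, so `λ₁(M) > 0` (`le_firstEigenvalueManifold`),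
contradicting `λ₁(M) = 0`.

The main labour is the divergence theorem for a volume and a divergence defined through preferred
charts. Change of variables shows that the volume measure is `√(det g) dy` in each chart
(`riemannianVolume_restrict_source`). For `ψ` supported in one chart, the theorem then says that the
integral of a coordinate derivative vanishes (`integral_chartDivergence`). This local version forces
the divergence to be independent of the chart (`chartDivergence_eq_divergence`), and a partition of
unity makes it global (`integral_mul_divergence`).

On Euclidean space the test-function inequality is contradicted directly by the dilations `φ(ε y)`,
whose Rayleigh quotients tend to `0` with `ε` (`exists_energy_lt_mass_euclideanSpace`). -/

noncomputable section

namespace RiemannianSpectrum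

/-! ### The metric in the preferred charts -/

section Charts

variable {n : ℕ} {M : Type*} [TopologicalSpace M] [ChartedSpace (EuclideanSpace ℝ (Fin n)) M]
  [IsManifold (𝓡 n) ∞ M]

lemma mfderiv_extChartAt_mfderiv_symm (x : M) {y : EuclideanSpace ℝ (Fin n)}
    (hy : y ∈ (extChartAt (𝓡 n) x).target) (v : EuclideanSpace ℝ (Fin n)) :
    mfderiv (𝓡 n) (𝓡 n) (extChartAt (𝓡 n) x) ((extChartAt (𝓡 n) x).symm y)
      (mfderiv (𝓡 n) (𝓡 n) (extChartAt (𝓡 n) x).symm y v) = v := by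
  have h := mfderiv_extChartAt_comp_mfderivWithin_extChartAt_symm (I := 𝓡 n) hy
  rw [ModelWithCorners.range_eq_univ, mfderivWithin_univ] at h
  exact congrArg (fun L ↦ L v) h

lemma mfderiv_symm_mfderiv_extChartAt (x : M) {y : EuclideanSpace ℝ (Fin n)}
    (hy : y ∈ (extChartAt (𝓡 n) x).target)
    (v : TangentSpace (𝓡 n) ((extChartAt (𝓡 n) x).symm y)) :
    mfderiv (𝓡 n) (𝓡 n) (extChartAt (𝓡 n) x).symm y
      (mfderiv (𝓡 n) (𝓡 n) (extChartAt (𝓡 n) x) ((extChartAt (𝓡 n) x).symm y) v) = v := by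
  have h := mfderivWithin_extChartAt_symm_comp_mfderiv_extChartAt (I := 𝓡 n) hy
  rw [ModelWithCorners.range_eq_univ, mfderivWithin_univ] at h
  exact congrArg (fun L ↦ L v) h

lemma contMDiffOn_mfderiv_symm (x : M) (v : EuclideanSpace ℝ (Fin n)) :
    ContMDiffOn (𝓡 n) (𝓡 n).tangent ∞
      (fun y ↦ (⟨(extChartAt (𝓡 n) x).symm y,
        mfderiv (𝓡 n) (𝓡 n) (extChartAt (𝓡 n) x).symm y v⟩ : TangentBundle (𝓡 n) M))
      (extChartAt (𝓡 n) x).target := by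
  have ho : IsOpen (extChartAt (𝓡 n) x).target := isOpen_extChartAt_target x
  have h := (contMDiffOn_extChartAt_symm (I := 𝓡 n) (n := ∞) x).contMDiffOn_tangentMapWithin
    (m := ∞) le_rfl ho.uniqueMDiffOn
  have h2 : ContMDiffOn (𝓡 n) (𝓡 n).tangent ∞
      (fun y ↦ (⟨y, v⟩ : TangentBundle (𝓡 n) (EuclideanSpace ℝ (Fin n))))
      (extChartAt (𝓡 n) x).target :=
    contMDiffOn_vectorSpace_iff_contDiffOn.2 contDiffOn_const
  refine (h.comp h2 (fun y hy ↦ hy)).congr fun y hy ↦ ?_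
  simp only [Function.comp, tangentMapWithin, mfderivWithin_of_isOpen ho hy]

/-- The components are the fibre part of the tangent map of the chart composed with `X` along the
inverse chart, a composition of smooth maps. -/
lemma contDiffOn_coordComponents {X : Π x : M, TangentSpace (𝓡 n) x}
    (hX : ContMDiff (𝓡 n) (𝓡 n).tangent ∞ (fun x ↦ (⟨x, X x⟩ : TangentBundle (𝓡 n) M))) (x : M) :
    ContDiffOn ℝ ∞ (coordComponents X x) (extChartAt (𝓡 n) x).target := by
  have ho : IsOpen (extChartAt (𝓡 n) x).source := isOpen_extChartAt_source x
  have h := (contMDiffOn_extChartAt (I := 𝓡 n) (n := ∞) (x := x)).contMDiffOn_tangentMapWithin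
    (m := ∞) le_rfl (extChartAt_source (𝓡 n) x ▸ ho).uniqueMDiffOn
  have h1 := hX.comp_contMDiffOn (contMDiffOn_extChartAt_symm (I := 𝓡 n) (n := ∞) x)
  have h2 := h.comp h1 (fun y hy ↦ by
    simpa using (extChartAt (𝓡 n) x).map_target hy)
  have h3 := (contMDiff_snd_tangentBundle_modelSpace (n := ∞) (EuclideanSpace ℝ (Fin n))
    (𝓡 n)).comp_contMDiffOn h2
  refine (contMDiffOn_iff_contDiffOn.1 h3).congr fun y hy ↦ ?_
  simp only [Function.comp, tangentMapWithin, coordComponents]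
  rw [mfderivWithin_of_isOpen (extChartAt_source (𝓡 n) x ▸ ho)
    (by simpa using (extChartAt (𝓡 n) x).map_target hy)]

end Charts

/-! ### Gram matrices, the volume density and its transformation law -/

section Metric

variable {n : ℕ} {M : Type*} [TopologicalSpace M] [ChartedSpace (EuclideanSpace ℝ (Fin n)) M]
  [RiemannianBundle (fun x : M ↦ TangentSpace (𝓡 n) x)]

/-- The metric at `z` as a bilinear form on the model space. -/
def metricForm (z : M) : LinearMap.BilinForm ℝ (EuclideanSpace ℝ (Fin n)) :=
  LinearMap.mk₂ ℝ
    (fun v w ↦ inner ℝ (E := TangentSpace (𝓡 n) z) v w)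
    (fun _ _ _ ↦ inner_add_left (E := TangentSpace (𝓡 n) z) _ _ _)
    (fun _ _ _ ↦ real_inner_smul_left (F := TangentSpace (𝓡 n) z) _ _ _)
    (fun _ _ _ ↦ inner_add_right (E := TangentSpace (𝓡 n) z) _ _ _)
    (fun _ _ _ ↦ real_inner_smul_right (F := TangentSpace (𝓡 n) z) _ _ _)

/-- The derivative of the inverse chart, as an endomorphism of the model space. -/
def symmDeriv (x : M) (y : EuclideanSpace ℝ (Fin n)) :
    EuclideanSpace ℝ (Fin n) →L[ℝ] EuclideanSpace ℝ (Fin n) :=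
  mfderiv (𝓡 n) (𝓡 n) (extChartAt (𝓡 n) x).symm y

/-- Viewing the Gram matrix as a pulled-back form on the fixed model space reduces a change of chart
to the congruence rule `Jᵀ G J` for matrices of bilinear forms. -/
lemma metricMatrix_eq_toMatrix (x : M) (y : EuclideanSpace ℝ (Fin n)) :
    metricMatrix x y = LinearMap.BilinForm.toMatrix (EuclideanSpace.basisFun (Fin n) ℝ).toBasis
      ((metricForm ((extChartAt (𝓡 n) x).symm y)).comp (symmDeriv x y).toLinearMap
        (symmDeriv x y).toLinearMap) := by
  ext i j
  rw [LinearMap.BilinForm.toMatrix_apply]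
  simp only [OrthonormalBasis.coe_toBasis, EuclideanSpace.basisFun_apply]
  rfl

variable [IsManifold (𝓡 n) ∞ M]

/-- A Gram matrix of linearly independent vectors is positive definite; the coordinate vectors are
independent because the differential of the inverse chart has a left inverse. -/
lemma metricMatrix_posDef (x : M) {y : EuclideanSpace ℝ (Fin n)}
    (hy : y ∈ (extChartAt (𝓡 n) x).target) : (metricMatrix x y).PosDef := by
  have hli : LinearIndependent ℝ (coordVector x y) := by
    have hb : LinearIndependent ℝ (fun i : Fin n ↦ EuclideanSpace.single i (1 : ℝ)) := by
      have h := (EuclideanSpace.basisFun (Fin n) ℝ).toBasis.linearIndependent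
      rwa [show ⇑(EuclideanSpace.basisFun (Fin n) ℝ).toBasis =
        fun i : Fin n ↦ EuclideanSpace.single i (1 : ℝ) by ext1 i; simp] at h
    have hinj : Function.Injective
        (mfderiv (𝓡 n) (𝓡 n) (extChartAt (𝓡 n) x).symm y) := fun v w h ↦ by
      rw [← mfderiv_extChartAt_mfderiv_symm x hy v, h, mfderiv_extChartAt_mfderiv_symm x hy w]
    exact hb.map' (mfderiv (𝓡 n) (𝓡 n) (extChartAt (𝓡 n) x).symm y).toLinearMap
      (LinearMap.ker_eq_bot.2 hinj)
  exact Matrix.posDef_gram_of_linearIndependent hli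

lemma volumeDensity_pos (x : M) {y : EuclideanSpace ℝ (Fin n)}
    (hy : y ∈ (extChartAt (𝓡 n) x).target) : 0 < volumeDensity x y :=
  Real.sqrt_pos.2 (metricMatrix_posDef x hy).det_pos

/-- The determinant is polynomial in the smooth entries `g_{ij}`, and it does not vanish on the
chart target, so the square root stays smooth. -/
lemma contDiffOn_volumeDensity [IsContMDiffRiemannianBundle (𝓡 n) ∞ (EuclideanSpace ℝ (Fin n))
    (fun x : M ↦ TangentSpace (𝓡 n) x)] (x : M) :
    ContDiffOn ℝ ∞ (volumeDensity x) (extChartAt (𝓡 n) x).target := by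
  have h : ∀ i j, ContDiffOn ℝ ∞ (fun y ↦ metricMatrix x y i j) (extChartAt (𝓡 n) x).target :=
    fun i j ↦ contMDiffOn_iff_contDiffOn.1
      ((contMDiffOn_mfderiv_symm x (EuclideanSpace.single i (1 : ℝ))).inner_bundle
        (contMDiffOn_mfderiv_symm x (EuclideanSpace.single j (1 : ℝ))))
  refine ContDiffOn.sqrt ?_ fun y hy ↦ (metricMatrix_posDef x hy).det_pos.ne'
  simp only [Matrix.det_apply]
  exact ContDiffOn.sum fun σ _ ↦ (contDiffOn_prod fun i _ ↦ h _ _).const_smul _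

lemma aemeasurable_volumeDensity [IsContMDiffRiemannianBundle (𝓡 n) ∞ (EuclideanSpace ℝ (Fin n))
    (fun x : M ↦ TangentSpace (𝓡 n) x)] (x : M) :
    AEMeasurable (fun y ↦ ENNReal.ofReal (volumeDensity x y))
      (volume.restrict (extChartAt (𝓡 n) x).target) :=
  ((contDiffOn_volumeDensity x).continuousOn.aemeasurable
    (isOpen_extChartAt_target x).measurableSet).ennreal_ofReal

/-- The transition map from the preferred chart at `x` to the one at `x'`. -/
def transition (x x' : M) (y : EuclideanSpace ℝ (Fin n)) : EuclideanSpace ℝ (Fin n) :=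
  extChartAt (𝓡 n) x' ((extChartAt (𝓡 n) x).symm y)

/-- By the chain rule the two inverse-chart differentials differ by the Jacobian `J` of the
transition map, while the base point, hence the metric form, is the same. So `det G = (det J)² det
G'`, and taking roots produces `|det J|`, the factor in the change of variables formula. -/
lemma volumeDensity_transition (x x' : M) {y : EuclideanSpace ℝ (Fin n)}
    (hy : y ∈ (extChartAt (𝓡 n) x).target)
    (hy' : (extChartAt (𝓡 n) x).symm y ∈ (extChartAt (𝓡 n) x').source) :
    DifferentiableAt ℝ (transition x x' : EuclideanSpace ℝ (Fin n) → _) y ∧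
    volumeDensity x y =
      |(fderiv ℝ (transition x x') y).det| * volumeDensity x' (transition x x' y) := by
  have hs : IsOpen (extChartAt (𝓡 n) x').source := isOpen_extChartAt_source x'
  have hy'' : (extChartAt (𝓡 n) x).symm y ∈ (chartAt (EuclideanSpace ℝ (Fin n)) x').source := by
    simpa using hy'
  have hd : MDifferentiableAt (𝓡 n) (𝓡 n) (extChartAt (𝓡 n) x).symm y :=
    (mdifferentiableOn_extChartAt_symm y hy).mdifferentiableAt
      ((isOpen_extChartAt_target x).mem_nhds hy)
  have hd' := mdifferentiableAt_extChartAt (I := 𝓡 n) hy''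
  obtain ⟨D, hτ⟩ : ∃ D : EuclideanSpace ℝ (Fin n) →L[ℝ] EuclideanSpace ℝ (Fin n),
      HasMFDerivAt (𝓡 n) (𝓡 n) (transition x x') y D :=
    ⟨_, hd'.hasMFDerivAt.comp y hd.hasMFDerivAt⟩
  have hτ' : HasFDerivAt (transition x x') D y := hasMFDerivAt_iff_hasFDerivAt.1 hτ
  have hτy : (extChartAt (𝓡 n) x').symm (transition x x' y) = (extChartAt (𝓡 n) x).symm y :=
    (extChartAt (𝓡 n) x').left_inv hy'
  have hty : transition x x' y ∈ (extChartAt (𝓡 n) x').target :=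
    (extChartAt (𝓡 n) x').map_source hy'
  have hcomp : symmDeriv x y =
      (symmDeriv x' (transition x x' y)).comp (fderiv ℝ (transition x x') y) := by
    have hd'' : MDifferentiableAt (𝓡 n) (𝓡 n) (extChartAt (𝓡 n) x').symm (transition x x' y) :=
      (mdifferentiableOn_extChartAt_symm _ hty).mdifferentiableAt
        ((isOpen_extChartAt_target x').mem_nhds hty)
    have h1 := hd''.hasMFDerivAt.comp y hτ
    have h2 : (extChartAt (𝓡 n) x).symm =ᶠ[𝓝 y]
        (extChartAt (𝓡 n) x').symm ∘ transition x x' := by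
      filter_upwards [hd.continuousAt.preimage_mem_nhds (hs.mem_nhds hy')] with w hw
      exact ((extChartAt (𝓡 n) x').left_inv hw).symm
    have h3 := (h1.congr_of_eventuallyEq h2).mfderiv
    rw [hτ'.fderiv]
    exact h3
  refine ⟨hτ'.differentiableAt, ?_⟩
  have hdet : (metricMatrix x y).det =
      (fderiv ℝ (transition x x') y).det ^ 2 * (metricMatrix x' (transition x x' y)).det := by
    rw [metricMatrix_eq_toMatrix, metricMatrix_eq_toMatrix, hcomp, hτy]
    have h := LinearMap.BilinForm.toMatrix_comp (EuclideanSpace.basisFun (Fin n) ℝ).toBasis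
      (EuclideanSpace.basisFun (Fin n) ℝ).toBasis
      ((metricForm ((extChartAt (𝓡 n) x).symm y)).comp
        (symmDeriv x' (transition x x' y)).toLinearMap
        (symmDeriv x' (transition x x' y)).toLinearMap)
      (fderiv ℝ (transition x x') y).toLinearMap (fderiv ℝ (transition x x') y).toLinearMap
    have h' := congrArg Matrix.det h
    rw [Matrix.det_mul, Matrix.det_mul, Matrix.det_transpose, LinearMap.det_toMatrix] at h'
    refine h'.trans ?_
    rw [show (fderiv ℝ (transition x x') y).det =
      LinearMap.det (fderiv ℝ (transition x x') y).toLinearMap from rfl]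
    ring
  rw [volumeDensity, volumeDensity, hdet, Real.sqrt_mul (sq_nonneg _), Real.sqrt_sq_eq_abs]

end Metric

/-! ### The Riemannian volume in the preferred charts -/

/-- Charts and their inverses are continuous only on their domains, so preimages of Borel sets are
controlled only after intersecting with the domain. -/
lemma measurableSet_inter_preimage_of_continuousOn {α β : Type*} [TopologicalSpace α]
    [MeasurableSpace α] [OpensMeasurableSpace α] [TopologicalSpace β] [MeasurableSpace β]
    [BorelSpace β] {f : α → β} {s : Set α} (hf : ContinuousOn f s) (hs : MeasurableSet s)
    {t : Set β} (ht : MeasurableSet t) : MeasurableSet (s ∩ f ⁻¹' t) := by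
  have h := hs.subtype_image (hf.domRestrict.measurable ht)
  convert h using 1
  ext a
  simp [and_comm]

section Volume

variable {n : ℕ} {M : Type*} [TopologicalSpace M] [ChartedSpace (EuclideanSpace ℝ (Fin n)) M]
  [MeasurableSpace M] [BorelSpace M]

lemma aemeasurable_extChartAt_symm (x : M) :
    AEMeasurable (extChartAt (𝓡 n) x).symm (volume.restrict (extChartAt (𝓡 n) x).target) :=
  (continuousOn_extChartAt_symm x).aemeasurable (isOpen_extChartAt_target x).measurableSet

variable [RiemannianBundle (fun x : M ↦ TangentSpace (𝓡 n) x)]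

lemma aemeasurable_extChartAt_symm_withDensity (x : M) :
    AEMeasurable (extChartAt (𝓡 n) x).symm ((volume.restrict
      (extChartAt (𝓡 n) x).target).withDensity
        (fun y ↦ ENNReal.ofReal (volumeDensity x y))) :=
  (aemeasurable_extChartAt_symm x).mono_ac (withDensity_absolutelyContinuous _ _)

lemma chartVolume_apply (x : M) {B : Set M} (hB : MeasurableSet B) :
    chartVolume (n := n) x B =
      ∫⁻ y in (extChartAt (𝓡 n) x).target ∩ (extChartAt (𝓡 n) x).symm ⁻¹' B,
        ENNReal.ofReal (volumeDensity x y) := by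
  have ht : MeasurableSet (extChartAt (𝓡 n) x).target :=
    (isOpen_extChartAt_target x).measurableSet
  rw [chartVolume, Measure.map_apply_of_aemeasurable
    (aemeasurable_extChartAt_symm_withDensity x) hB, withDensity_apply',
    Measure.restrict_restrict' ht, inter_comm]

lemma chartVolume_inter_source (x : M) {B : Set M} (hB : MeasurableSet B) :
    chartVolume (n := n) x (B ∩ (extChartAt (𝓡 n) x).source) = chartVolume (n := n) x B := by
  rw [chartVolume_apply x hB,
    chartVolume_apply x (hB.inter (isOpen_extChartAt_source x).measurableSet)]
  congr 2
  ext y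
  simp only [mem_inter_iff, mem_preimage]
  exact ⟨fun h ↦ ⟨h.1, h.2.1⟩, fun h ↦ ⟨h.1, h.2, (extChartAt (𝓡 n) x).map_target h.1⟩⟩

section Overlap

variable [IsManifold (𝓡 n) ∞ M]

/-- The change of variables formula: the chart volumes agree on overlaps. -/
lemma chartVolume_eq_of_subset (x x' : M) {B : Set M} (hB : MeasurableSet B)
    (hBx : B ⊆ (extChartAt (𝓡 n) x).source) (hBx' : B ⊆ (extChartAt (𝓡 n) x').source) :
    chartVolume (n := n) x B = chartVolume (n := n) x' B := by
  have hS := measurableSet_inter_preimage_of_continuousOn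
    (continuousOn_extChartAt_symm (I := 𝓡 n) x) (isOpen_extChartAt_target x).measurableSet hB
  have himage : transition x x' ''
      ((extChartAt (𝓡 n) x).target ∩ (extChartAt (𝓡 n) x).symm ⁻¹' B) =
      (extChartAt (𝓡 n) x').target ∩ (extChartAt (𝓡 n) x').symm ⁻¹' B := by
    ext z
    constructor
    · rintro ⟨y, ⟨hy, hyB⟩, rfl⟩
      refine ⟨(extChartAt (𝓡 n) x').map_source (hBx' hyB), ?_⟩
      rw [mem_preimage, transition, (extChartAt (𝓡 n) x').left_inv (hBx' hyB)]
      exact hyB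
    · rintro ⟨hz, hzB⟩
      refine ⟨extChartAt (𝓡 n) x ((extChartAt (𝓡 n) x').symm z),
        ⟨(extChartAt (𝓡 n) x).map_source (hBx hzB), ?_⟩, ?_⟩
      · rw [mem_preimage, (extChartAt (𝓡 n) x).left_inv (hBx hzB)]
        exact hzB
      · rw [transition, (extChartAt (𝓡 n) x).left_inv (hBx hzB),
          (extChartAt (𝓡 n) x').right_inv hz]
  have hinj : InjOn (transition x x')
      ((extChartAt (𝓡 n) x).target ∩ (extChartAt (𝓡 n) x).symm ⁻¹' B) := by
    rintro y ⟨hy, hyB⟩ w ⟨hw, hwB⟩ h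
    have := (extChartAt (𝓡 n) x').injOn (hBx' hyB) (hBx' hwB) h
    exact (extChartAt (𝓡 n) x).symm.injOn hy hw this
  rw [chartVolume_apply x hB, chartVolume_apply x' hB, ← himage,
    lintegral_image_eq_lintegral_abs_det_fderiv_mul volume hS
      (fun y hy ↦ ((volumeDensity_transition x x' hy.1
        (hBx' hy.2)).1.hasFDerivAt.hasFDerivWithinAt)) hinj]
  refine setLIntegral_congr_fun hS fun y hy ↦ ?_
  rw [← ENNReal.ofReal_mul (abs_nonneg _)]
  exact congrArg _ (volumeDensity_transition x x' hy.1 (hBx' hy.2)).2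

/-- The Riemannian volume restricts to the chart volume on each chart domain. -/
lemma riemannianVolume_restrict_source (x : M) :
    (riemannianVolume n M).restrict (extChartAt (𝓡 n) x).source = chartVolume (n := n) x := by
  have hU : MeasurableSet (extChartAt (𝓡 n) x).source :=
    (isOpen_extChartAt_source x).measurableSet
  have hle : ∀ x' : M, chartVolume (n := n) x' ≤ riemannianVolume n M :=
    fun x' ↦ le_iSup (fun x' : M ↦ chartVolume (n := n) x') x'
  -- A supremum of measures is not computed set by set. Instead a measure dominating all chart
  -- volumes is exhibited: the chart volume at `x` plus the whole volume off the chart. On subsets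
  -- of the chart domain the second term vanishes.
  have hge : riemannianVolume n M ≤ chartVolume (n := n) x +
      (riemannianVolume n M).restrict (extChartAt (𝓡 n) x).sourceᶜ := by
    refine iSup_le fun x' ↦ Measure.le_iff.2 fun B hB ↦ ?_
    rw [Measure.add_apply, Measure.restrict_apply hB, ← sdiff_eq,
      ← measure_inter_add_sdiff B hU (μ := chartVolume (n := n) x')]
    refine add_le_add ?_ (hle x' _)
    · rw [← chartVolume_inter_source x' (hB.inter hU), chartVolume_eq_of_subset x' x
        ((hB.inter hU).inter (isOpen_extChartAt_source x').measurableSet) inter_subset_right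
        (inter_subset_left.trans inter_subset_right)]
      exact measure_mono (inter_subset_left.trans inter_subset_left)
  refine Measure.ext fun B hB ↦ ?_
  rw [Measure.restrict_apply hB, ← chartVolume_inter_source x hB]
  refine le_antisymm ((hge _).trans ?_) (hle x _)
  rw [Measure.add_apply, Measure.restrict_apply (hB.inter hU), inter_assoc, inter_compl_self]
  simp

end Overlap

variable [IsManifold (𝓡 n) ∞ M] [IsContMDiffRiemannianBundle (𝓡 n) ∞ (EuclideanSpace ℝ (Fin n))
  (fun x : M ↦ TangentSpace (𝓡 n) x)]

lemma integral_riemannianVolume_of_support_subset (x : M) {f : M → ℝ}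
    (hf : ContinuousOn f (extChartAt (𝓡 n) x).source)
    (hs : Function.support f ⊆ (extChartAt (𝓡 n) x).source) :
    ∫ z, f z ∂(riemannianVolume n M) = ∫ y in (extChartAt (𝓡 n) x).target,
      volumeDensity x y * f ((extChartAt (𝓡 n) x).symm y) := by
  rw [← setIntegral_eq_integral_of_forall_compl_eq_zero (s := (extChartAt (𝓡 n) x).source)
      (fun z hz ↦ Function.notMem_support.1 fun h ↦ hz (hs h)),
    riemannianVolume_restrict_source]
  have hm : AEStronglyMeasurable f (chartVolume (n := n) x) :=
    riemannianVolume_restrict_source (n := n) x ▸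
      hf.aestronglyMeasurable (isOpen_extChartAt_source x).measurableSet
  rw [chartVolume, integral_map (aemeasurable_extChartAt_symm_withDensity x) hm,
    integral_withDensity_eq_integral_toReal_smul₀ (aemeasurable_volumeDensity x)
      (Eventually.of_forall fun _ ↦ ENNReal.ofReal_lt_top)]
  refine integral_congr_ae (Eventually.of_forall fun y ↦ ?_)
  exact congrArg (· * _) (ENNReal.toReal_ofReal (Real.sqrt_nonneg _))

/-- The density is continuous, hence integrable over a compact coordinate neighbourhood. This makes
compactly supported continuous functions integrable. -/
instance : IsLocallyFiniteMeasure (riemannianVolume n M) := by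
  refine ⟨fun z ↦ ?_⟩
  obtain ⟨K, hK, hKt, hKc⟩ := local_compact_nhds (extChartAt_target_mem_nhds (I := 𝓡 n) z)
  refine ⟨(extChartAt (𝓡 n) z).source ∩ extChartAt (𝓡 n) z ⁻¹' K,
    inter_mem (extChartAt_source_mem_nhds z) ((continuousAt_extChartAt z).preimage_mem_nhds hK), ?_⟩
  have hm := measurableSet_inter_preimage_of_continuousOn (continuousOn_extChartAt (I := 𝓡 n) z)
    (isOpen_extChartAt_source z).measurableSet hKc.measurableSet
  rw [← inter_eq_self_of_subset_right (inter_subset_left (s := (extChartAt (𝓡 n) z).source)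
      (t := extChartAt (𝓡 n) z ⁻¹' K)), inter_comm, ← Measure.restrict_apply hm,
    riemannianVolume_restrict_source, chartVolume_apply z hm]
  refine (lintegral_mono_set (t := K) fun y hy ↦ ?_).trans_lt
    (((contDiffOn_volumeDensity z).continuousOn.mono hKt).integrableOn_compact
      hKc).lintegral_lt_top
  have h := hy.2.2
  rwa [mem_preimage, (extChartAt (𝓡 n) z).right_inv hy.1] at h

/-- The density is strictly positive on the chart target. This lets almost everywhere identities
between continuous functions be upgraded to pointwise ones. -/
instance : (riemannianVolume n M).IsOpenPosMeasure := by
  refine ⟨fun U hU ⟨z, hz⟩ h0 ↦ ?_⟩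
  have ht : IsOpen (extChartAt (𝓡 n) z).target := isOpen_extChartAt_target z
  have hV : IsOpen ((extChartAt (𝓡 n) z).target ∩ (extChartAt (𝓡 n) z).symm ⁻¹' U) :=
    (continuousOn_extChartAt_symm z).isOpen_inter_preimage ht hU
  have hne : ((extChartAt (𝓡 n) z).target ∩ (extChartAt (𝓡 n) z).symm ⁻¹' U).Nonempty :=
    ⟨extChartAt (𝓡 n) z z, mem_extChartAt_target z, by simpa using hz⟩
  have h1 : chartVolume (n := n) z U = 0 := by
    rw [← riemannianVolume_restrict_source, Measure.restrict_apply hU.measurableSet]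
    exact measure_mono_null inter_subset_left h0
  rw [chartVolume_apply z hU.measurableSet, lintegral_eq_zero_iff' ((aemeasurable_volumeDensity
    z).mono_measure (Measure.restrict_mono inter_subset_left le_rfl))] at h1
  refine hV.measure_ne_zero volume hne ?_
  refine measure_mono_null (fun y hy ↦ ?_) ((ae_restrict_iff' hV.measurableSet).1 h1)
  have hpos : ¬ ENNReal.ofReal (volumeDensity z y) = 0 :=
    (ENNReal.ofReal_pos.2 (volumeDensity_pos z hy.1)).ne'
  exact fun h ↦ hpos (h hy)

end Volume

/-! ### The divergence theorem -/

/-- Integration by parts against the constant function `1`. -/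
lemma integral_fderiv_apply_eq_zero {E : Type*} [NormedAddCommGroup E] [NormedSpace ℝ E]
    [FiniteDimensional ℝ E] [MeasurableSpace E] [BorelSpace E] (μ : Measure E)
    [μ.IsAddHaarMeasure] {h : E → ℝ} (hh : ContDiff ℝ 1 h) (hc : HasCompactSupport h) (v : E) :
    ∫ y, fderiv ℝ h y v ∂μ = 0 := by
  have hi : Integrable (fun y ↦ fderiv ℝ h y v) μ :=
    ((hh.continuous_fderiv one_ne_zero).clm_apply continuous_const).integrable_of_hasCompactSupport
      (hc.fderiv_apply ℝ v)
  have := integral_mul_fderiv_eq_neg_fderiv_mul_of_integrable (𝕜 := ℝ) (μ := μ) (f := fun _ ↦ 1)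
    (g := h) (v := v) (by simp) (by simpa using hi)
    (by simpa using hh.continuous.integrable_of_hasCompactSupport hc)
    (fun _ _ ↦ by fun_prop) (fun y _ ↦ hh.differentiable one_ne_zero y)
  simpa using this

lemma integrable_of_continuousOn_of_isCompact {α : Type*} [TopologicalSpace α] [T2Space α]
    [MeasurableSpace α] [OpensMeasurableSpace α] {μ : Measure α} [IsFiniteMeasureOnCompacts μ]
    {f : α → ℝ} {U K : Set α} (hf : ContinuousOn f U) (hK : IsCompact K) (hKU : K ⊆ U)
    (hsupp : Function.support f ⊆ K) : Integrable f μ :=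
  (integrableOn_iff_integrable_of_support_subset hsupp).1 ((hf.mono hKU).integrableOn_compact hK)

section Derivative

variable {n : ℕ} {M : Type*} [TopologicalSpace M] [ChartedSpace (EuclideanSpace ℝ (Fin n)) M]

lemma mvfderiv_eq_zero_of_notMem_tsupport {ψ : M → ℝ} {z : M} (hz : z ∉ tsupport ψ) :
    mvfderiv (𝓡 n) ψ z = 0 := by
  have h : ψ =ᶠ[𝓝 z] fun _ ↦ 0 := notMem_tsupport_iff_eventuallyEq.1 hz
  rw [← mvfderiv_const (I := 𝓡 n) (x := z) (0 : ℝ), mvfderiv, mvfderiv, h.mfderiv_eq, h.eq_of_nhds]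

variable [IsManifold (𝓡 n) ∞ M]

lemma continuous_mvfderiv_apply {X : Π x : M, TangentSpace (𝓡 n) x}
    (hX : ContMDiff (𝓡 n) (𝓡 n).tangent ∞ (fun x ↦ (⟨x, X x⟩ : TangentBundle (𝓡 n) M)))
    {ψ : M → ℝ} (hψ : ContMDiff (𝓡 n) 𝓘(ℝ, ℝ) ∞ ψ) :
    Continuous fun z ↦ mvfderiv (𝓡 n) ψ z (X z) :=
  ((contMDiff_snd_tangentBundle_modelSpace (n := 0) ℝ 𝓘(ℝ, ℝ)).continuous.comp
    ((hψ.continuous_tangentMap (by simp)).comp hX.continuous) :)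

/-- Chain rule: the differential of the inverse chart undoes the differential of the chart that
defines the components. -/
lemma fderiv_comp_symm_coordComponents (X : Π x : M, TangentSpace (𝓡 n) x) {ψ : M → ℝ}
    (hψ : ContMDiff (𝓡 n) 𝓘(ℝ, ℝ) ∞ ψ) (x : M) {y : EuclideanSpace ℝ (Fin n)}
    (hy : y ∈ (extChartAt (𝓡 n) x).target) :
    fderiv ℝ (ψ ∘ (extChartAt (𝓡 n) x).symm) y (coordComponents X x y) =
      mvfderiv (𝓡 n) ψ ((extChartAt (𝓡 n) x).symm y) (X ((extChartAt (𝓡 n) x).symm y)) := by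
  have hd : MDifferentiableAt (𝓡 n) (𝓡 n) (extChartAt (𝓡 n) x).symm y :=
    (mdifferentiableOn_extChartAt_symm y hy).mdifferentiableAt
      ((isOpen_extChartAt_target x).mem_nhds hy)
  have h := mvfderiv_comp_apply (I := 𝓡 n) y (hψ.mdifferentiableAt (by simp)) hd
    (coordComponents X x y)
  rw [coordComponents, mfderiv_symm_mfderiv_extChartAt x hy] at h
  rw [← h]
  simp [mvfderiv]
  rfl

end Derivative

section Divergence

variable {n : ℕ} {M : Type*} [TopologicalSpace M] [ChartedSpace (EuclideanSpace ℝ (Fin n)) M]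
  [RiemannianBundle (fun x : M ↦ TangentSpace (𝓡 n) x)] [IsManifold (𝓡 n) ∞ M]
  [IsContMDiffRiemannianBundle (𝓡 n) ∞ (EuclideanSpace ℝ (Fin n))
    (fun x : M ↦ TangentSpace (𝓡 n) x)]

/-- The divergence of `X` at `z`, computed in the preferred chart at `x`. -/
def chartDivergence (X : Π x : M, TangentSpace (𝓡 n) x) (x z : M) : ℝ :=
  (volumeDensity x (extChartAt (𝓡 n) x z))⁻¹ *
    ∑ i : Fin n,
      fderiv ℝ (fun y ↦ volumeDensity x y * coordComponents X x y i) (extChartAt (𝓡 n) x z)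
        (EuclideanSpace.single i (1 : ℝ))

variable {X : Π x : M, TangentSpace (𝓡 n) x}
  (hX : ContMDiff (𝓡 n) (𝓡 n).tangent ∞ (fun x ↦ (⟨x, X x⟩ : TangentBundle (𝓡 n) M)))

include hX

lemma contDiffOn_volumeDensity_mul_coordComponents (x : M) (i : Fin n) :
    ContDiffOn ℝ ∞ (fun y ↦ volumeDensity x y * coordComponents X x y i)
      (extChartAt (𝓡 n) x).target :=
  (contDiffOn_volumeDensity x).mul (contDiffOn_euclidean.1 (contDiffOn_coordComponents hX x) i)

lemma continuousOn_chartDivergence (x : M) :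
    ContinuousOn (chartDivergence X x) (extChartAt (𝓡 n) x).source := by
  have hmaps : MapsTo (extChartAt (𝓡 n) x) (extChartAt (𝓡 n) x).source
      (extChartAt (𝓡 n) x).target := (extChartAt (𝓡 n) x).mapsTo
  have hc := continuousOn_extChartAt (I := 𝓡 n) x
  refine ContinuousOn.mul ?_ (continuousOn_finsetSum _ fun i _ ↦ ?_)
  · exact ((contDiffOn_volumeDensity x).continuousOn.comp hc hmaps).inv₀
      fun z hz ↦ (volumeDensity_pos x (hmaps hz)).ne'
  · exact (((contDiffOn_volumeDensity_mul_coordComponents hX x i).continuousOn_fderiv_of_isOpen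
      (isOpen_extChartAt_target x) (by simp)).clm_apply continuousOn_const).comp hc hmaps

variable [MeasurableSpace M] [BorelSpace M]

/-- The divergence theorem for `ψ • X` with `ψ` supported in a chart domain. -/
lemma integral_chartDivergence (x : M) {ψ : M → ℝ} (hψ : ContMDiff (𝓡 n) 𝓘(ℝ, ℝ) ∞ ψ)
    (hψc : HasCompactSupport ψ) (hψs : tsupport ψ ⊆ (extChartAt (𝓡 n) x).source) :
    ∫ z, (ψ z * chartDivergence X x z + mvfderiv (𝓡 n) ψ z (X z)) ∂(riemannianVolume n M) = 0 := by
  have ht : IsOpen (extChartAt (𝓡 n) x).target := isOpen_extChartAt_target x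
  rw [integral_riemannianVolume_of_support_subset x
    (f := fun z ↦ ψ z * chartDivergence X x z + mvfderiv (𝓡 n) ψ z (X z))
    ((hψ.continuous.continuousOn.mul (continuousOn_chartDivergence hX x)).add
      (continuous_mvfderiv_apply hX hψ).continuousOn)
    (fun z hz ↦ by
      by_contra h
      have h' : z ∉ tsupport ψ := fun h2 ↦ h (hψs h2)
      simp [image_eq_zero_of_notMem_tsupport h', mvfderiv_eq_zero_of_notMem_tsupport h'] at hz)]
  -- `ψ √(det g) Xⁱ` extended by zero to the whole model space. The extension is smooth because its
  -- support lies in a compact subset of the open chart target.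
  set h : Fin n → EuclideanSpace ℝ (Fin n) → ℝ := fun i ↦ (extChartAt (𝓡 n) x).target.indicator
    fun y ↦ ψ ((extChartAt (𝓡 n) x).symm y) * (volumeDensity x y * coordComponents X x y i)
  have hev : ∀ i, ∀ y ∈ (extChartAt (𝓡 n) x).target, h i =ᶠ[𝓝 y] (fun y ↦
      (ψ ∘ (extChartAt (𝓡 n) x).symm) y * (volumeDensity x y * coordComponents X x y i)) :=
    fun i y hy ↦ eventuallyEq_of_mem (ht.mem_nhds hy) (eqOn_indicator ..)
  have hψd : ContDiffOn ℝ ∞ (ψ ∘ (extChartAt (𝓡 n) x).symm) (extChartAt (𝓡 n) x).target :=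
    contMDiffOn_iff_contDiffOn.1 (hψ.comp_contMDiffOn (contMDiffOn_extChartAt_symm x))
  have hK : IsCompact (extChartAt (𝓡 n) x '' tsupport ψ) :=
    hψc.image_of_continuousOn ((continuousOn_extChartAt x).mono hψs)
  have hKt : extChartAt (𝓡 n) x '' tsupport ψ ⊆ (extChartAt (𝓡 n) x).target :=
    (image_mono hψs).trans (extChartAt (𝓡 n) x).mapsTo.image_subset
  have hzero : ∀ i, ∀ y ∉ extChartAt (𝓡 n) x '' tsupport ψ, h i y = 0 := fun i y hy ↦ by
    by_cases hyt : y ∈ (extChartAt (𝓡 n) x).target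
    · have : (extChartAt (𝓡 n) x).symm y ∉ tsupport ψ := fun h' ↦
        hy ⟨_, h', (extChartAt (𝓡 n) x).right_inv hyt⟩
      rw [(hev i y hyt).eq_of_nhds, Function.comp_apply, image_eq_zero_of_notMem_tsupport this,
        zero_mul]
    · exact indicator_of_notMem hyt _
  have hcs : ∀ i, HasCompactSupport (h i) := fun i ↦ .intro hK (hzero i)
  have hsm : ∀ i, ContDiff ℝ ∞ (h i) := fun i ↦ by
    refine contDiff_iff_contDiffAt.2 fun y ↦ ?_
    by_cases hyt : y ∈ (extChartAt (𝓡 n) x).target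
    · exact ((hψd.mul (contDiffOn_volumeDensity_mul_coordComponents hX x i)).contDiffAt
        (ht.mem_nhds hyt)).congr_of_eventuallyEq (hev i y hyt)
    · exact contDiffAt_const.congr_of_eventuallyEq (eventuallyEq_of_mem
        (hK.isClosed.isOpen_compl.mem_nhds fun h' ↦ hyt (hKt h')) (hzero i))
  -- The product rule for `∂ᵢ (ψ · √(det g) Xⁱ)`: the density cancels the inverse density in the
  -- divergence, and the terms `∂ᵢψ Xⁱ` sum to `dψ(X)`.
  have hpt : ∀ y ∈ (extChartAt (𝓡 n) x).target,
      volumeDensity x y * (ψ ((extChartAt (𝓡 n) x).symm y) *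
        chartDivergence X x ((extChartAt (𝓡 n) x).symm y) +
        mvfderiv (𝓡 n) ψ ((extChartAt (𝓡 n) x).symm y) (X ((extChartAt (𝓡 n) x).symm y))) =
      ∑ i, fderiv ℝ (h i) y (EuclideanSpace.single i (1 : ℝ)) := fun y hy ↦ by
    have hsum : coordComponents X x y =
        ∑ i, coordComponents X x y i • EuclideanSpace.single i (1 : ℝ) := by
      simpa using ((EuclideanSpace.basisFun (Fin n) ℝ).sum_repr (coordComponents X x y)).symm
    rw [← fderiv_comp_symm_coordComponents X hψ x hy, chartDivergence,
      (extChartAt (𝓡 n) x).right_inv hy]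
    conv_lhs => enter [2, 2]; rw [hsum]
    rw [map_sum, mul_add, mul_left_comm, mul_inv_cancel_left₀ (volumeDensity_pos x hy).ne',
      Finset.mul_sum, Finset.mul_sum, ← Finset.sum_add_distrib]
    refine Finset.sum_congr rfl fun i _ ↦ ?_
    rw [(hev i y hy).fderiv_eq, fderiv_fun_mul
      ((hψd.contDiffAt (ht.mem_nhds hy)).differentiableAt (by simp))
      (((contDiffOn_volumeDensity_mul_coordComponents hX x i).contDiffAt
        (ht.mem_nhds hy)).differentiableAt (by simp))]
    simp
    ring
  rw [setIntegral_congr_fun ht.measurableSet hpt,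
    setIntegral_eq_integral_of_forall_compl_eq_zero (fun y hy ↦ ?_), integral_finsetSum]
  · exact Finset.sum_eq_zero fun i _ ↦
      integral_fderiv_apply_eq_zero volume ((hsm i).of_le (by simp)) (hcs i) _
  · exact fun i _ ↦ (((hsm i).continuous_fderiv (by simp)).clm_apply
      continuous_const).integrable_of_hasCompactSupport ((hcs i).fderiv_apply ℝ _)
  · refine Finset.sum_eq_zero fun i _ ↦ ?_
    have : h i =ᶠ[𝓝 y] fun _ ↦ 0 := eventuallyEq_of_mem
      (hK.isClosed.isOpen_compl.mem_nhds fun h' ↦ hy (hKt h')) (hzero i)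
    rw [this.fderiv_eq]
    simp

variable [T2Space M]

lemma integrable_mul_chartDivergence (x : M) {ψ : M → ℝ} (hψ : ContMDiff (𝓡 n) 𝓘(ℝ, ℝ) ∞ ψ)
    (hψc : HasCompactSupport ψ) (hψs : tsupport ψ ⊆ (extChartAt (𝓡 n) x).source) :
    Integrable (fun z ↦ ψ z * chartDivergence X x z) (riemannianVolume n M) :=
  integrable_of_continuousOn_of_isCompact
    (hψ.continuous.continuousOn.mul (continuousOn_chartDivergence hX x)) hψc hψs
    ((Function.support_mul_subset_left _ _).trans (subset_tsupport ψ))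

lemma integrable_mvfderiv_apply {ψ : M → ℝ} (hψ : ContMDiff (𝓡 n) 𝓘(ℝ, ℝ) ∞ ψ)
    (hψc : HasCompactSupport ψ) :
    Integrable (fun z ↦ mvfderiv (𝓡 n) ψ z (X z)) (riemannianVolume n M) :=
  integrable_of_continuousOn_of_isCompact (continuous_mvfderiv_apply hX hψ).continuousOn
    hψc (subset_univ _) fun z hz ↦ by
      by_contra h'
      simp [mvfderiv_eq_zero_of_notMem_tsupport h'] at hz

variable [SecondCountableTopology M]

/-- The divergence does not depend on the chart in which it is computed. -/
lemma chartDivergence_eq_divergence (x : M) {z : M} (hz : z ∈ (extChartAt (𝓡 n) x).source) :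
    chartDivergence X x z = divergence X z := by
  have : LocallyCompactSpace M := ChartedSpace.locallyCompactSpace (EuclideanSpace ℝ (Fin n)) M
  have hU : IsOpen ((extChartAt (𝓡 n) x).source ∩ (extChartAt (𝓡 n) z).source) :=
    (isOpen_extChartAt_source x).inter (isOpen_extChartAt_source z)
  have hc := (continuousOn_chartDivergence hX x).mono
    (inter_subset_left (t := (extChartAt (𝓡 n) z).source))
  have hc' := (continuousOn_chartDivergence hX z).mono
    (inter_subset_right (s := (extChartAt (𝓡 n) x).source))
  -- Tested against any `g` supported in the overlap, both chart divergences give `-∫ dg(X)`, which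
  -- mentions no chart. Hence they agree almost everywhere there, then everywhere by continuity,
  -- with no coordinate computation.
  have hae := hU.ae_eq_zero_of_integral_contMDiff_smul_eq_zero (𝓡 n)
    (μ := riemannianVolume n M)
    (f := fun w ↦ chartDivergence X x w - chartDivergence X z w)
    ((hc.sub hc').locallyIntegrableOn hU.measurableSet) (fun g hg hgc hgs ↦ by
      have h1 := integral_chartDivergence hX x hg hgc (hgs.trans inter_subset_left)
      have h2 := integral_chartDivergence hX z hg hgc (hgs.trans inter_subset_right)
      have i1 := integrable_mul_chartDivergence hX x hg hgc (hgs.trans inter_subset_left)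
      have i2 := integrable_mul_chartDivergence hX z hg hgc (hgs.trans inter_subset_right)
      have i3 := integrable_mvfderiv_apply hX hg hgc
      rw [integral_add i1 i3] at h1
      rw [integral_add i2 i3] at h2
      simp only [smul_eq_mul, mul_sub]
      rw [integral_sub i1 i2]
      linarith)
  have heq := Measure.eqOn_open_of_ae_eq (μ := riemannianVolume n M)
    (((ae_restrict_iff' hU.measurableSet).2 hae).mono fun w hw ↦ sub_eq_zero.1 hw) hU hc hc'
  exact heq ⟨hz, mem_extChartAt_source z⟩

/-- The definition changes chart from point to point, so continuity rests on chart independence: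
near `x` one fixed chart computes the divergence. -/
lemma continuous_divergence : Continuous (divergence X) := by
  refine continuous_iff_continuousAt.2 fun x ↦ ?_
  refine ((continuousOn_chartDivergence hX x).continuousAt
    (extChartAt_source_mem_nhds x)).congr ?_
  filter_upwards [extChartAt_source_mem_nhds (I := 𝓡 n) x] with z hz
  exact chartDivergence_eq_divergence hX x hz

lemma integrable_mul_divergence {φ : M → ℝ} (hφ : ContMDiff (𝓡 n) 𝓘(ℝ, ℝ) ∞ φ)
    (hφc : HasCompactSupport φ) :
    Integrable (fun z ↦ φ z * divergence X z) (riemannianVolume n M) :=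
  (hφ.continuous.mul (continuous_divergence hX)).integrable_of_hasCompactSupport hφc.mul_right

/-- The divergence theorem for `φ • X`, where `φ` has compact support. -/
theorem integral_mul_divergence {φ : M → ℝ} (hφ : ContMDiff (𝓡 n) 𝓘(ℝ, ℝ) ∞ φ)
    (hφc : HasCompactSupport φ) :
    ∫ z, (φ z * divergence X z + mvfderiv (𝓡 n) φ z (X z)) ∂(riemannianVolume n M) = 0 := by
  have : LocallyCompactSpace M := ChartedSpace.locallyCompactSpace (EuclideanSpace ℝ (Fin n)) M
  obtain ⟨t, ht⟩ := hφc.elim_nhds_subcover (fun x : M ↦ (extChartAt (𝓡 n) x).source)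
    fun x _ ↦ extChartAt_source_mem_nhds x
  -- The index set is a finite subcover of the compact support of `φ`, so the decomposition of `φ`
  -- is a finite sum and commutes with the derivative and the integral.
  obtain ⟨ρ, hρ⟩ := SmoothPartitionOfUnity.exists_isSubordinate (𝓡 n) (isClosed_tsupport φ)
    (fun x : t ↦ (extChartAt (𝓡 n) (x : M)).source) (fun x ↦ isOpen_extChartAt_source _)
    (by simpa [iUnion_subtype] using ht.2)
  have hsm : ∀ i : t, ContMDiff (𝓡 n) 𝓘(ℝ, ℝ) ∞ (fun z ↦ ρ i z * φ z) :=
    fun i ↦ (ρ i).contMDiff.mul hφ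
  have hcs : ∀ i : t, HasCompactSupport (fun z ↦ ρ i z * φ z) := fun i ↦ hφc.mul_left
  have hsum : φ = fun z ↦ ∑ i : t, ρ i z * φ z := by
    ext z
    by_cases hz : z ∈ tsupport φ
    · rw [← Finset.sum_mul, ← finsum_eq_sum_of_fintype, ρ.sum_eq_one hz, one_mul]
    · simp [image_eq_zero_of_notMem_tsupport hz]
  have hderiv : ∀ (s : Finset t) (z : M),
      mvfderiv (𝓡 n) (fun z ↦ ∑ i ∈ s, ρ i z * φ z) z (X z) =
        ∑ i ∈ s, mvfderiv (𝓡 n) (fun z ↦ ρ i z * φ z) z (X z) := fun s z ↦ by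
    classical
    induction s using Finset.induction_on with
    | empty => simp [mvfderiv_const]
    | insert i s hi ih =>
      simp only [Finset.sum_insert hi]
      rw [mvfderiv_fun_add ((hsm i).mdifferentiableAt (by simp))
        ((contMDiff_finsetSum (t := s) fun j _ ↦ hsm j).mdifferentiableAt (by simp)), ← ih]
      rfl
  have hpt : ∀ z, φ z * divergence X z + mvfderiv (𝓡 n) φ z (X z) =
      ∑ i : t, (ρ i z * φ z * divergence X z +
        mvfderiv (𝓡 n) (fun z ↦ ρ i z * φ z) z (X z)) := fun z ↦ by
    rw [Finset.sum_add_distrib, ← hderiv, ← Finset.sum_mul, ← hsum]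
    rw [← congrFun hsum z]
  simp only [hpt]
  have hint : ∀ i : t, Integrable (fun z ↦ ρ i z * φ z * divergence X z +
      mvfderiv (𝓡 n) (fun z ↦ ρ i z * φ z) z (X z)) (riemannianVolume n M) := fun i ↦
    (integrable_mul_divergence hX (hsm i) (hcs i)).add
      (integrable_mvfderiv_apply hX (hsm i) (hcs i))
  rw [integral_finsetSum _ fun i _ ↦ hint i]
  refine Finset.sum_eq_zero fun i _ ↦ ?_
  have hts : tsupport (fun z ↦ ρ i z * φ z) ⊆ (extChartAt (𝓡 n) (i : M)).source :=
    tsupport_mul_subset_left.trans (hρ i)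
  rw [← integral_chartDivergence hX i (hsm i) (hcs i) hts]
  refine integral_congr_ae (Eventually.of_forall fun z ↦ ?_)
  -- Chart independence is available only inside the chart domain; off the support the coefficient
  -- of the divergence is zero.
  by_cases hz : z ∈ tsupport (fun z ↦ ρ i z * φ z)
  · simp only [chartDivergence_eq_divergence hX i (hts hz)]
  · have h0 : ρ i z * φ z = 0 := image_eq_zero_of_notMem_tsupport (f := fun z ↦ ρ i z * φ z) hz
    simp only [h0, zero_mul]

end Divergence

section

/-! ### A Poincaré inequality for test functions -/

section Supports

variable {n : ℕ} {M : Type*} [TopologicalSpace M] [ChartedSpace (EuclideanSpace ℝ (Fin n)) M]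
  [RiemannianBundle (fun x : M ↦ TangentSpace (𝓡 n) x)]

lemma inner_grad (f : M → ℝ) (z : M) (v : TangentSpace (𝓡 n) z) :
    inner ℝ (grad (n := n) f z) v = mvfderiv (𝓡 n) f z v := by
  have : FiniteDimensional ℝ (TangentSpace (𝓡 n) z) :=
    inferInstanceAs (FiniteDimensional ℝ (EuclideanSpace ℝ (Fin n)))
  have : CompleteSpace (TangentSpace (𝓡 n) z) := FiniteDimensional.complete ℝ _
  exact InnerProductSpace.toDual_symm_apply

lemma grad_eq_zero_of_notMem_tsupport {f : M → ℝ} {z : M} (hz : z ∉ tsupport f) :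
    grad (n := n) f z = 0 := by
  rw [grad, mvfderiv_eq_zero_of_notMem_tsupport hz, map_zero]

variable [MeasurableSpace M]

lemma mass_eq_mass_univ {Ω : Set M} {f : M → ℝ} (hf : Function.support f ⊆ Ω) :
    mass n Ω f = mass n univ f := by
  rw [mass, mass, Measure.restrict_univ]
  refine setLIntegral_eq_of_support_subset fun z hz ↦ hf fun h ↦ hz ?_
  simp [h]

lemma energy_eq_energy_univ {Ω : Set M} {f : M → ℝ} (hf : tsupport f ⊆ Ω) :
    energy n Ω f = energy n univ f := by
  rw [energy, energy, Measure.restrict_univ]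
  refine setLIntegral_eq_of_support_subset fun z hz ↦ hf ?_
  by_contra h
  exact hz (by simp [grad_eq_zero_of_notMem_tsupport h])

lemma mass_eq_eLpNorm_sq (Ω : Set M) (f : M → ℝ) :
    mass n Ω f = eLpNorm f 2 ((riemannianVolume n M).restrict Ω) ^ 2 := by
  have h := eLpNorm_nnreal_pow_eq_lintegral (f := f) (p := 2)
    (μ := (riemannianVolume n M).restrict Ω) two_ne_zero
  simpa [mass] using h.symm

end Supports

variable {n : ℕ} {M : Type*} [TopologicalSpace M] [ChartedSpace (EuclideanSpace ℝ (Fin n)) M]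
  [RiemannianBundle (fun x : M ↦ TangentSpace (𝓡 n) x)] [IsManifold (𝓡 n) ∞ M]
  [IsContMDiffRiemannianBundle (𝓡 n) ∞ (EuclideanSpace ℝ (Fin n))
    (fun x : M ↦ TangentSpace (𝓡 n) x)]
  [MeasurableSpace M] [BorelSpace M]

lemma IsTestFunction.mass_lt_top {Ω : Set M} {φ : M → ℝ} (hφ : IsTestFunction n Ω φ)
    (Ω' : Set M) : mass n Ω' φ < ⊤ := by
  have h := (hφ.1.continuous.memLp_of_hasCompactSupport hφ.2.1
    (p := 2) (μ := riemannianVolume n M)).restrict Ω'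
  rw [mass_eq_eLpNorm_sq]
  exact ENNReal.pow_lt_top h.2

variable [T2Space M] [SecondCountableTopology M]

/-- The divergence theorem for `φ² X`, followed by Cauchy–Schwarz and Young's inequality. The weight
`c / 2` is chosen so that half of `c ∫ φ²` survives absorption. -/
lemma IsTestFunction.mass_le_energy {X : Π x : M, TangentSpace (𝓡 n) x}
    (hX : ContMDiff (𝓡 n) (𝓡 n).tangent ∞ (fun x ↦ (⟨x, X x⟩ : TangentBundle (𝓡 n) M)))
    {C c : ℝ} (hC : ∀ x, ‖X x‖ ≤ C) (hc : 0 < c) (hdiv : ∀ x, c ≤ divergence X x)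
    {Ω : Set M} {φ : M → ℝ} (hφ : IsTestFunction n Ω φ) :
    ENNReal.ofReal (c / 2) * mass n Ω φ ≤ ENNReal.ofReal (2 * C ^ 2 / c) * energy n Ω φ := by
  obtain ⟨hsm, hcs, hts⟩ := hφ
  have hfin : mass n univ φ < ⊤ := IsTestFunction.mass_lt_top ⟨hsm, hcs, hts⟩ univ
  rw [mass_eq_mass_univ ((subset_tsupport φ).trans hts), energy_eq_energy_univ hts]
  have hsm2 : ContMDiff (𝓡 n) 𝓘(ℝ, ℝ) ∞ (fun z ↦ φ z * φ z) := hsm.mul hsm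
  have hcs2 : HasCompactSupport (fun z ↦ φ z * φ z) := hcs.mul_left
  have hdφ : ∀ z, mvfderiv (𝓡 n) (fun z ↦ φ z * φ z) z (X z) =
      2 * (φ z * inner ℝ (grad (n := n) φ z) (X z)) := fun z ↦ by
    rw [mvfderiv_fun_mul (hsm.mdifferentiableAt (by simp)) (hsm.mdifferentiableAt (by simp)),
      inner_grad]
    simp
    ring
  have i1 := integrable_mul_divergence hX hsm2 hcs2
  have hint := integral_mul_divergence hX hsm2 hcs2
  rw [integral_add i1 (integrable_mvfderiv_apply hX hsm2 hcs2), add_eq_zero_iff_eq_neg,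
    ← integral_neg] at hint
  have hle : ENNReal.ofReal c * mass n univ φ ≤ ENNReal.ofReal (c / 2) * mass n univ φ +
      ENNReal.ofReal (2 * C ^ 2 / c) * energy n univ φ := by
    simp only [mass, energy, Measure.restrict_univ]
    rw [← lintegral_const_mul' _ _ ENNReal.ofReal_ne_top,
      ← lintegral_const_mul' _ _ ENNReal.ofReal_ne_top,
      ← lintegral_const_mul' _ _ ENNReal.ofReal_ne_top]
    calc ∫⁻ z, ENNReal.ofReal c * ‖φ z‖ₑ ^ 2 ∂(riemannianVolume n M)
        ≤ ∫⁻ z, ENNReal.ofReal (φ z * φ z * divergence X z) ∂(riemannianVolume n M) := by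
          refine lintegral_mono fun z ↦ ?_
          rw [Real.enorm_eq_ofReal_abs, ← ENNReal.ofReal_pow (abs_nonneg _), sq_abs,
            ← ENNReal.ofReal_mul hc.le]
          refine ENNReal.ofReal_le_ofReal ?_
          nlinarith [mul_le_mul_of_nonneg_left (hdiv z) (mul_self_nonneg (φ z))]
      _ = ENNReal.ofReal (∫ z, φ z * φ z * divergence X z ∂(riemannianVolume n M)) :=
          (ofReal_integral_eq_lintegral_ofReal i1 (Eventually.of_forall fun z ↦
            mul_nonneg (mul_self_nonneg _) (hc.le.trans (hdiv z)))).symm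
      _ ≤ ∫⁻ z, ENNReal.ofReal (c / 2) * ‖φ z‖ₑ ^ 2 +
            ENNReal.ofReal (2 * C ^ 2 / c) * ‖grad (n := n) φ z‖ₑ ^ 2
              ∂(riemannianVolume n M) := by
          rw [hint]
          refine (ENNReal.ofReal_le_ofReal (Real.le_norm_self _)).trans ?_
          rw [ofReal_norm]
          refine (enorm_integral_le_lintegral_enorm _).trans (lintegral_mono fun z ↦ ?_)
          rw [hdφ, ← ofReal_norm, ← ofReal_norm, ← ofReal_norm,
            ← ENNReal.ofReal_pow (norm_nonneg _), ← ENNReal.ofReal_pow (norm_nonneg _),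
            ← ENNReal.ofReal_mul (by positivity), ← ENNReal.ofReal_mul (by positivity),
            ← ENNReal.ofReal_add (by positivity) (by positivity)]
          refine ENNReal.ofReal_le_ofReal ?_
          rw [norm_neg, norm_mul, norm_mul, Real.norm_ofNat]
          have h1 : ‖(inner ℝ (grad (n := n) φ z) (X z) : ℝ)‖ ≤ ‖grad (n := n) φ z‖ * C :=
            (norm_inner_le_norm _ _).trans (mul_le_mul_of_nonneg_left (hC z) (norm_nonneg _))
          have h2 : 2 * (‖φ z‖ * (‖grad (n := n) φ z‖ * C)) ≤
              c / 2 * ‖φ z‖ ^ 2 + 2 * C ^ 2 / c * ‖grad (n := n) φ z‖ ^ 2 := by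
            -- Young's inequality as an explicit completed square.
            have h3 : c / 2 * ‖φ z‖ ^ 2 + 2 * C ^ 2 / c * ‖grad (n := n) φ z‖ ^ 2 -
                2 * (‖φ z‖ * (‖grad (n := n) φ z‖ * C)) =
                (c * ‖φ z‖ - 2 * C * ‖grad (n := n) φ z‖) ^ 2 / (2 * c) := by
              field_simp
              ring
            have h4 : 0 ≤ (c * ‖φ z‖ - 2 * C * ‖grad (n := n) φ z‖) ^ 2 / (2 * c) := by positivity
            linarith
          exact (by gcongr : (2 : ℝ) * (‖φ z‖ * ‖(inner ℝ (grad (n := n) φ z) (X z) : ℝ)‖) ≤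
            2 * (‖φ z‖ * (‖grad (n := n) φ z‖ * C))).trans h2
      -- Measurability of one summand suffices to split the integral, so none is needed for `|∇φ|`.
      _ = _ := lintegral_add_left' ((hsm.continuous.measurable.enorm.pow_const
          2).const_mul _).aemeasurable _
  rw [← add_halves c, ENNReal.ofReal_add (by positivity) (by positivity), add_mul,
    add_halves c] at hle
  -- Subtracting the common term in `ℝ≥0∞` requires the mass of `φ` to be finite.
  exact (ENNReal.add_le_add_iff_left (ENNReal.mul_lt_top ENNReal.ofReal_lt_top hfin).ne).1 hle

/-- A bounded vector field with divergence bounded below by a positive constant forces a positive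
lower bound for all Rayleigh quotients of test functions. -/
lemma exists_mul_mass_le_energy {X : Π x : M, TangentSpace (𝓡 n) x}
    (hX : ContMDiff (𝓡 n) (𝓡 n).tangent ∞ (fun x ↦ (⟨x, X x⟩ : TangentBundle (𝓡 n) M)))
    (hC : ∃ C : ℝ, ∀ x, ‖X x‖ ≤ C) (hdiv : 0 < ⨅ x, divergence X x) :
    ∃ κ : ℝ≥0∞, κ ≠ 0 ∧ κ ≠ ⊤ ∧ ∀ (Ω : Set M) (φ : M → ℝ), IsTestFunction n Ω φ →
      κ * mass n Ω φ ≤ energy n Ω φ := by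
  obtain ⟨C, hC⟩ := hC
  -- A real infimum over a family not bounded below is `0` by convention, so positivity of the
  -- infimum already implies boundedness below.
  have hbdd : BddBelow (range (divergence X)) := by
    by_contra h
    rw [Real.iInf_of_not_bddBelow h] at hdiv
    exact lt_irrefl _ hdiv
  set c := ⨅ x, divergence X x
  -- Enlarging the bound makes it strictly positive, so that `K` can be inverted; the resulting
  -- constant is `c² / (4 (|C| + 1)²)`.
  have hC' : ∀ x, ‖X x‖ ≤ |C| + 1 := fun x ↦ by linarith [hC x, le_abs_self C]
  have hK : 0 < 2 * (|C| + 1) ^ 2 / c := by positivity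
  set K := ENNReal.ofReal (2 * (|C| + 1) ^ 2 / c)
  have hK0 : K ≠ 0 := (ENNReal.ofReal_pos.2 hK).ne'
  refine ⟨K⁻¹ * ENNReal.ofReal (c / 2), mul_ne_zero (ENNReal.inv_ne_zero.2 ENNReal.ofReal_ne_top)
    (ENNReal.ofReal_pos.2 (by positivity)).ne',
    ENNReal.mul_ne_top (ENNReal.inv_ne_top.2 hK0) ENNReal.ofReal_ne_top, fun Ω φ hφ ↦ ?_⟩
  have h := hφ.mass_le_energy hX hC' hdiv fun x ↦ ciInf_le hbdd x
  rw [mul_assoc]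
  calc _ ≤ K⁻¹ * (K * energy n Ω φ) := by gcongr
    _ = _ := ENNReal.inv_mul_cancel_left hK0 ENNReal.ofReal_ne_top

end

section

/-! ### Lower bounds for the first eigenvalue -/

section Monotonicity

variable {n : ℕ} {M : Type*} [TopologicalSpace M] [ChartedSpace (EuclideanSpace ℝ (Fin n)) M]

lemma IsTestFunction.sub {Ω : Set M} {φ ψ : M → ℝ} (hφ : IsTestFunction n Ω φ)
    (hψ : IsTestFunction n Ω ψ) : IsTestFunction n Ω (φ - ψ) :=
  ⟨hφ.1.sub hψ.1, hφ.2.1.sub hψ.2.1,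
    (tsupport_sub φ ψ).trans (union_subset hφ.2.2 hψ.2.2)⟩

lemma IsTestFunction.mono {Ω Ω' : Set M} (h : Ω ⊆ Ω') {φ : M → ℝ} (hφ : IsTestFunction n Ω φ) :
    IsTestFunction n Ω' φ :=
  ⟨hφ.1, hφ.2.1, hφ.2.2.trans h⟩

variable [RiemannianBundle (fun x : M ↦ TangentSpace (𝓡 n) x)] [MeasurableSpace M]

lemma IsTestFunction.mass_eq {Ω Ω' : Set M} (h : Ω ⊆ Ω') {φ : M → ℝ}
    (hφ : IsTestFunction n Ω φ) : mass n Ω' φ = mass n Ω φ := by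
  rw [mass_eq_mass_univ ((subset_tsupport φ).trans hφ.2.2),
    mass_eq_mass_univ ((subset_tsupport φ).trans (hφ.2.2.trans h))]

lemma IsTestFunction.energy_eq {Ω Ω' : Set M} (h : Ω ⊆ Ω') {φ : M → ℝ}
    (hφ : IsTestFunction n Ω φ) : energy n Ω' φ = energy n Ω φ := by
  rw [energy_eq_energy_univ hφ.2.2, energy_eq_energy_univ (hφ.2.2.trans h)]

lemma mass_indicator {Ω Ω' : Set M} (h : Ω ⊆ Ω') (hΩ : MeasurableSet Ω) (f : M → ℝ) :
    mass n Ω' (Ω.indicator f) = mass n Ω f := by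
  rw [mass_eq_mass_univ (support_indicator_subset.trans h),
    ← mass_eq_mass_univ (support_indicator_subset (s := Ω) (f := f)), mass, mass]
  exact setLIntegral_congr_fun hΩ fun z hz ↦ by simp only [indicator_of_mem hz]

/-- Extension by zero preserves `L²_{1,0}`. -/
lemma IsSobolevWithEnergy.indicator {Ω Ω' : Set M} (h : Ω ⊆ Ω') (hΩ : MeasurableSet Ω)
    {f : M → ℝ} {D : ℝ≥0∞} (hf : IsSobolevWithEnergy n Ω f D) :
    IsSobolevWithEnergy n Ω' (Ω.indicator f) D := by
  obtain ⟨hm, φ, hφ, hcauchy, hlim, hD⟩ := hf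
  refine ⟨?_, φ, fun k ↦ (hφ k).mono h, ?_, ?_, ?_⟩
  · refine (aestronglyMeasurable_indicator_iff hΩ).2 ?_
    rwa [Measure.restrict_restrict hΩ, inter_eq_self_of_subset_left h]
  · refine hcauchy.congr fun p ↦ ?_
    rw [((hφ p.1).sub (hφ p.2)).mass_eq h, ((hφ p.1).sub (hφ p.2)).energy_eq h]
  · refine hlim.congr fun k ↦ ?_
    have hk : φ k - Ω.indicator f = Ω.indicator (φ k - f) := by
      rw [indicator_sub', indicator_eq_self.2 ((subset_tsupport _).trans (hφ k).2.2)]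
    rw [hk, mass_indicator h hΩ]
  · exact hD.congr fun k ↦ ((hφ k).energy_eq h).symm

/-- Extension by zero keeps the mass and the energy, so every Rayleigh quotient on the smaller set
also occurs on the larger one. -/
lemma firstEigenvalue_anti {Ω Ω' : Set M} (h : Ω ⊆ Ω') (hΩ : MeasurableSet Ω) :
    firstEigenvalue n Ω' ≤ firstEigenvalue n Ω := by
  refine sInf_le_sInf ?_
  rintro l ⟨f, D, hf, hne, rfl⟩
  refine ⟨Ω.indicator f, D, hf.indicator h hΩ, fun h0 ↦ hne ?_, ?_⟩
  · have h1 := ae_restrict_of_ae_restrict_of_subset h h0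
    filter_upwards [h1, ae_restrict_mem hΩ] with z hz hzΩ
    rwa [indicator_of_mem hzΩ] at hz
  · rw [mass_indicator h hΩ]

end Monotonicity

variable {n : ℕ} {M : Type*}

section LowerBound

variable [TopologicalSpace M] [ChartedSpace (EuclideanSpace ℝ (Fin n)) M]
  [RiemannianBundle (fun x : M ↦ TangentSpace (𝓡 n) x)] [IsManifold (𝓡 n) ∞ M]
  [IsContMDiffRiemannianBundle (𝓡 n) ∞ (EuclideanSpace ℝ (Fin n))
    (fun x : M ↦ TangentSpace (𝓡 n) x)]
  [MeasurableSpace M] [BorelSpace M]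

/-- A lower bound for the Rayleigh quotients of test functions extends to `L²_{1,0}(Ω)`. -/
lemma le_firstEigenvalue {κ : ℝ≥0∞} (hκ : κ ≠ ⊤) {Ω : Set M}
    (h : ∀ φ : M → ℝ, IsTestFunction n Ω φ → κ * mass n Ω φ ≤ energy n Ω φ) :
    κ ≤ firstEigenvalue n Ω := by
  refine le_sInf ?_
  rintro l ⟨f, D, ⟨hm, φ, hφ, -, hlim, hD⟩, hne, rfl⟩
  set μ := (riemannianVolume n M).restrict Ω
  have hsqrt : ∀ g : M → ℝ, mass n Ω g ^ (1 / 2 : ℝ) = eLpNorm g 2 μ := fun g ↦ by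
    rw [mass_eq_eLpNorm_sq, ← ENNReal.rpow_natCast_mul]
    norm_num
    rfl
  have hφm : ∀ k, AEStronglyMeasurable (φ k) μ :=
    fun k ↦ (hφ k).1.continuous.aestronglyMeasurable
  have htri : ∀ k, eLpNorm f 2 μ ≤ eLpNorm (φ k) 2 μ + eLpNorm (φ k - f) 2 μ := fun k ↦ by
    have := eLpNorm_sub_le (hφm k) ((hφm k).sub hm) (p := 2) (by norm_num)
    rwa [sub_sub_cancel] at this
  have hlim' : Tendsto (fun k ↦ eLpNorm (φ k - f) 2 μ) atTop (𝓝 0) := by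
    have := (ENNReal.continuous_rpow_const (y := (1 / 2 : ℝ))).tendsto 0 |>.comp hlim
    rw [ENNReal.zero_rpow_of_pos (by norm_num)] at this
    exact this.congr fun k ↦ hsqrt _
  have hD' : Tendsto (fun k ↦ energy n Ω (φ k) ^ (1 / 2 : ℝ)) atTop (𝓝 (D ^ (1 / 2 : ℝ))) :=
    (ENNReal.continuous_rpow_const.tendsto D).comp hD
  have hκ' : κ ^ (1 / 2 : ℝ) ≠ ⊤ := ENNReal.rpow_ne_top_of_nonneg (by norm_num) hκ
  -- The limit is taken at the level of norms, after square roots, because there the triangle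
  -- inequality compares `f` with `φ k` and the error `φ k - f` tends to zero.
  have hmain : κ ^ (1 / 2 : ℝ) * eLpNorm f 2 μ ≤ D ^ (1 / 2 : ℝ) := by
    have hl : Tendsto (fun k ↦ energy n Ω (φ k) ^ (1 / 2 : ℝ) +
        κ ^ (1 / 2 : ℝ) * eLpNorm (φ k - f) 2 μ) atTop
        (𝓝 (D ^ (1 / 2 : ℝ) + κ ^ (1 / 2 : ℝ) * 0)) :=
      hD'.add (ENNReal.Tendsto.const_mul hlim' (Or.inr hκ'))
    rw [mul_zero, add_zero] at hl
    refine ge_of_tendsto' hl fun k ↦ ?_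
    calc _ ≤ κ ^ (1 / 2 : ℝ) * (eLpNorm (φ k) 2 μ + eLpNorm (φ k - f) 2 μ) := by
          gcongr
          exact htri k
      _ ≤ _ := by
        rw [mul_add]
        gcongr
        rw [← hsqrt, ← ENNReal.mul_rpow_of_nonneg _ _ (by norm_num)]
        exact ENNReal.rpow_le_rpow (h _ (hφ k)) (by norm_num)
  have hle : κ * mass n Ω f ≤ D := by
    rw [← hsqrt, ← ENNReal.mul_rpow_of_nonneg _ _ (by norm_num)] at hmain
    exact (ENNReal.rpow_le_rpow_iff (by norm_num)).1 hmain
  have hfin : mass n Ω f ≠ ⊤ := by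
    obtain ⟨k, hk⟩ := (hlim'.eventually (gt_mem_nhds ENNReal.zero_lt_top)).exists
    rw [mass_eq_eLpNorm_sq]
    refine ENNReal.pow_ne_top ((htri k).trans_lt (ENNReal.add_lt_top.2 ⟨?_, hk⟩)).ne
    rw [← hsqrt]
    exact ENNReal.rpow_lt_top_of_nonneg (by norm_num) ((hφ k).mass_lt_top Ω).ne
  have hpos : mass n Ω f ≠ 0 := fun h0 ↦ hne <| by
    rw [mass_eq_eLpNorm_sq, sq_eq_zero_iff, eLpNorm_eq_zero_iff hm two_ne_zero] at h0
    exact h0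
  exact (ENNReal.le_div_iff_mul_le (Or.inl hpos) (Or.inl hfin)).2 hle

end LowerBound

/-- `limUnder` carries information only if the limit exists; by monotonicity in the radius it does,
and it equals the infimum over all radii. -/
lemma le_firstEigenvalueManifold [MetricSpace M] [ChartedSpace (EuclideanSpace ℝ (Fin n)) M]
    [RiemannianBundle (fun x : M ↦ TangentSpace (𝓡 n) x)] [MeasurableSpace M]
    [OpensMeasurableSpace M] (p : M) {κ : ℝ≥0∞}
    (h : ∀ r : ℝ, κ ≤ firstEigenvalue n (Metric.ball p r)) :
    κ ≤ firstEigenvalueManifold n p := by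
  have hanti : Antitone fun r : ℝ ↦ firstEigenvalue n (Metric.ball p r) := fun r s hrs ↦
    firstEigenvalue_anti (Metric.ball_subset_ball hrs) Metric.isOpen_ball.measurableSet
  rw [firstEigenvalueManifold, (tendsto_atTop_iInf hanti).limUnder_eq]
  exact le_iInf h

end

/-! ### Euclidean space -/

section Euclidean

variable {n : ℕ}

lemma volumeDensity_euclideanSpace (x y : EuclideanSpace ℝ (Fin n)) : volumeDensity x y = 1 := by
  have h : metricMatrix x y = 1 := by
    rw [metricMatrix_eq_toMatrix]
    have hD : symmDeriv x y = ContinuousLinearMap.id ℝ _ := by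
      have hid : ((extChartAt (𝓡 n) x).symm : EuclideanSpace ℝ (Fin n) → _) = id := by
        simp [chartAt_self_eq]
      rw [symmDeriv, hid]
      exact mfderiv_id
    rw [hD]
    ext i j
    rw [LinearMap.BilinForm.toMatrix_apply]
    simp only [OrthonormalBasis.coe_toBasis]
    exact (orthonormal_iff_ite.1 (EuclideanSpace.basisFun (Fin n) ℝ).orthonormal i j).trans
      (Matrix.one_apply ..).symm
  rw [volumeDensity, h, Matrix.det_one, Real.sqrt_one]

lemma riemannianVolume_euclideanSpace :
    riemannianVolume n (EuclideanSpace ℝ (Fin n)) = volume := by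
  rw [← Measure.restrict_univ (μ := riemannianVolume n (EuclideanSpace ℝ (Fin n)))]
  have h := riemannianVolume_restrict_source (n := n) (0 : EuclideanSpace ℝ (Fin n))
  rw [chartVolume] at h
  simp only [extChartAt_model_space_eq_id, volumeDensity_euclideanSpace] at h
  simpa using h

lemma enorm_grad_euclideanSpace (φ : EuclideanSpace ℝ (Fin n) → ℝ)
    (y : EuclideanSpace ℝ (Fin n)) : ‖grad (n := n) φ y‖ₑ = ‖fderiv ℝ φ y‖ₑ := by
  -- The same vector seen in the model space: the tangent space norm comes from the Riemannian
  -- structure, and has to be identified with the Euclidean norm.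
  let G : EuclideanSpace ℝ (Fin n) := grad (n := n) φ y
  have h : G = (InnerProductSpace.toDual ℝ (EuclideanSpace ℝ (Fin n))).symm (fderiv ℝ φ y) := by
    refine ext_inner_right ℝ fun v ↦ ?_
    rw [InnerProductSpace.toDual_symm_apply]
    refine (inner_grad φ y v).trans ?_
    simp [mvfderiv]
    rfl
  refine (enorm_tangentSpace_vectorSpace (v := grad (n := n) φ y)).trans ?_
  change ‖G‖ₑ = _
  rw [h]
  exact ((InnerProductSpace.toDual ℝ (EuclideanSpace ℝ (Fin n))).symm).toLinearIsometry.enorm_map _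

/-- For a fixed bump function `φ`, the dilation `φ(ε y)` has mass `ε⁻ⁿ m` and energy `ε² ε⁻ⁿ e`. A
lower bound `κ` on all quotients would give `κ m ≤ ε² e` for every `ε > 0`, impossible as `ε → 0`
since `m ≠ 0` and `e < ∞`. The argument includes `n = 0`. -/
lemma exists_energy_lt_mass_euclideanSpace {κ : ℝ≥0∞} (hκ : κ ≠ 0) :
    ∃ φ : EuclideanSpace ℝ (Fin n) → ℝ, IsTestFunction n univ φ ∧
      energy n univ φ < κ * mass n univ φ := by
  by_contra! hcon
  obtain ⟨φ, -, hc, hsm, -, h1⟩ := exists_contDiff_tsupport_subset (n := ⊤)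
    (univ_mem (f := 𝓝 (0 : EuclideanSpace ℝ (Fin n))))
  set m : ℝ≥0∞ := ∫⁻ y : EuclideanSpace ℝ (Fin n), ‖φ y‖ₑ ^ 2
  set e : ℝ≥0∞ := ∫⁻ y : EuclideanSpace ℝ (Fin n), ‖fderiv ℝ φ y‖ₑ ^ 2
  have hscale : ∀ (ε : ℝ), 0 < ε → ∀ F : EuclideanSpace ℝ (Fin n) → ℝ≥0∞, Measurable F →
      ∫⁻ y, F (ε • y) = ENNReal.ofReal |(ε ^ n)⁻¹| * ∫⁻ y, F y := fun ε hε F hF ↦ by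
    have h := Measure.map_addHaar_smul (volume : Measure (EuclideanSpace ℝ (Fin n))) hε.ne'
    rw [← lintegral_map hF (measurable_const_smul ε), h, lintegral_smul_measure]
    simp
  have hfd : Continuous (fderiv ℝ φ) := hsm.continuous_fderiv (by simp)
  have hle : ∀ ε : ℝ, 0 < ε → κ * m ≤ ENNReal.ofReal (ε ^ 2) * e := fun ε hε ↦ by
    have hsm' : ContDiff ℝ ∞ fun y ↦ φ (ε • y) := hsm.comp (contDiff_const_smul ε)
    have h := hcon (fun y ↦ φ (ε • y))
      ⟨hsm'.contMDiff, hc.comp_smul hε.ne', subset_univ _⟩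
    have hd : ∀ y, fderiv ℝ (fun y ↦ φ (ε • y)) y = ε • fderiv ℝ φ (ε • y) := fun y ↦
      fderiv_comp_smul ..
    simp only [mass, energy, Measure.restrict_univ, riemannianVolume_euclideanSpace,
      enorm_grad_euclideanSpace, hd, enorm_smul, mul_pow] at h
    rw [lintegral_const_mul' _ _ (by finiteness),
      hscale ε hε (fun y ↦ ‖φ y‖ₑ ^ 2) (hsm.continuous.measurable.enorm.pow_const 2),
      hscale ε hε (fun y ↦ ‖fderiv ℝ φ y‖ₑ ^ 2) (hfd.measurable.enorm.pow_const 2),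
      mul_left_comm, mul_left_comm (‖ε‖ₑ ^ 2), Real.enorm_of_nonneg hε.le,
      ← ENNReal.ofReal_pow hε.le] at h
    exact (ENNReal.mul_le_mul_iff_right (ENNReal.ofReal_pos.2 (by positivity)).ne'
      ENNReal.ofReal_ne_top).1 h
  have he : e ≠ ⊤ := by
    have h := ((hfd.memLp_of_hasCompactSupport (hc.fderiv ℝ) (p := 2)
      (μ := (volume : Measure (EuclideanSpace ℝ (Fin n)))))).2
    have h' := eLpNorm_nnreal_pow_eq_lintegral (f := fderiv ℝ φ) (p := 2)
      (μ := (volume : Measure (EuclideanSpace ℝ (Fin n)))) two_ne_zero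
    have h'' : e = eLpNorm (fderiv ℝ φ) 2 volume ^ 2 := by simpa [e] using h'.symm
    rw [h'']
    exact ENNReal.pow_ne_top h.ne
  have hm : m ≠ 0 := fun h0 ↦ by
    rw [lintegral_eq_zero_iff (hsm.continuous.measurable.enorm.pow_const 2)] at h0
    have h2 : φ =ᵐ[volume] fun _ ↦ 0 := h0.mono fun y hy ↦ by simpa using hy
    have h3 := (hsm.continuous.ae_eq_iff_eq volume continuous_const).1 h2
    simp [h3] at h1
  have hlim : Tendsto (fun ε : ℝ ↦ ENNReal.ofReal (ε ^ 2) * e) (𝓝[>] 0) (𝓝 0) := by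
    have h : Tendsto (fun ε : ℝ ↦ ENNReal.ofReal (ε ^ 2)) (𝓝[>] 0) (𝓝 0) := by
      have hcont : Continuous fun ε : ℝ ↦ ENNReal.ofReal (ε ^ 2) :=
        ENNReal.continuous_ofReal.comp (continuous_pow 2)
      simpa using (hcont.tendsto 0).mono_left nhdsWithin_le_nhds
    simpa using ENNReal.Tendsto.mul_const h (Or.inr he)
  have := ge_of_tendsto hlim (eventually_nhdsWithin_of_forall fun ε hε ↦ hle ε hε)
  exact mul_ne_zero hκ hm (le_antisymm this bot_le)

end Euclidean

end RiemannianSpectrum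

end

theorem corollary2p1 :
    (∀ (n : ℕ) (M : Type*) [MetricSpace M] [SecondCountableTopology M]
      [ChartedSpace (EuclideanSpace ℝ (Fin n)) M] [IsManifold (𝓡 n) ∞ M]
      [RiemannianBundle (fun x : M ↦ TangentSpace (𝓡 n) x)]
      [IsContMDiffRiemannianBundle (𝓡 n) ∞ (EuclideanSpace ℝ (Fin n))
        (fun x : M ↦ TangentSpace (𝓡 n) x)]
      [IsRiemannianManifold (𝓡 n) M]
      [MeasurableSpace M] [BorelSpace M]
      [CompleteSpace M] [NoncompactSpace M] (p : M),
      RiemannianSpectrum.firstEigenvalueManifold n p = 0 →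
      ¬ ∃ X : Π x : M, TangentSpace (𝓡 n) x,
        ContMDiff (𝓡 n) (𝓡 n).tangent ∞ (fun x ↦ (⟨x, X x⟩ : TangentBundle (𝓡 n) M)) ∧
        (∃ C : ℝ, ∀ x, ‖X x‖ ≤ C) ∧
        0 < ⨅ x, RiemannianSpectrum.divergence X x) ∧
    (∀ n : ℕ,
      ¬ ∃ X : Π x : EuclideanSpace ℝ (Fin n), TangentSpace (𝓡 n) x,
        ContMDiff (𝓡 n) (𝓡 n).tangent ∞
          (fun x ↦ (⟨x, X x⟩ : TangentBundle (𝓡 n) (EuclideanSpace ℝ (Fin n)))) ∧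
        (∃ C : ℝ, ∀ x, ‖X x‖ ≤ C) ∧
        0 < ⨅ x, RiemannianSpectrum.divergence X x) := by
  refine ⟨fun n M _ _ _ _ _ _ _ _ _ _ _ p h0 ⟨X, hX, hC, hdiv⟩ ↦ ?_,
    fun n ⟨X, hX, hC, hdiv⟩ ↦ ?_⟩
  · obtain ⟨κ, hκ0, hκ, h⟩ := RiemannianSpectrum.exists_mul_mass_le_energy hX hC hdiv
    have hle := RiemannianSpectrum.le_firstEigenvalueManifold (n := n) p fun r ↦
      RiemannianSpectrum.le_firstEigenvalue hκ (h (Metric.ball p r))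
    rw [h0] at hle
    exact hκ0 (le_antisymm hle bot_le)
  -- The first part is not invoked: for `n = 0` the space is a point, hence compact. The
  -- test-function inequality on the whole space is contradicted instead, uniformly in `n`.
  · obtain ⟨κ, hκ0, -, h⟩ := RiemannianSpectrum.exists_mul_mass_le_energy hX hC hdiv
    obtain ⟨φ, hφ, hlt⟩ := RiemannianSpectrum.exists_energy_lt_mass_euclideanSpace (n := n) hκ0
    exact (h univ φ hφ).not_gt hlt
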